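/- Let $f:(0,1)\times\mathbb R\to\mathbb R$ be any function, let $\lambda_0,\lambda_1\in\mathbb R\setminus\{0\}$ and $\kappa_0,\kappa_1\in\mathbb R$, and consider the Robin problem $$-\Big(\frac{u'}{\sqrt{1+(u')^2}}\Big)'=f(x,u)\ \ (0<x<1),\qquad \frac{u'(0)}{\sqrt{1+(u'(0))^2}}+\lambda_0u(0)=\kappa_0,\qquad \frac{u'(1)}{\sqrt{1+(u'(1))^2}}+\lambda_1u(1)=\kappa_1 .\tag{R}$$ For $v\in BV(0,1)$ write $Dv=D^av\,dx+D^sv$ for the Lebesgue decomposition of its derivative, $\frac{D^sv}{|D^sv|}$ for the density of $D^sv$ with respect to its total variation, and $v(0^+)$, $v(1^-)$ for its traces. A bounded variation solution of (R) is a function $u\in BV(0,1)$ such that $f(\cdot,u(\cdot))\in L^1(0,1)$ and $$\int_0^1\frac{D^au\,D^a\phi}{\sqrt{1+(D^au)^2}}\,dx+\int_0^1\frac{D^su}{|D^su|}\,D^s\phi+(\kappa_0-\lambda_0u(0^+))\,\phi(0^+)+(\lambda_1u(1^-)-\kappa_1)\,\phi(1^-)=\int_0^1f(x,u(x))\,\phi(x)\,dx$$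 for all $\phi\in BV(0,1)$ such that $|D^s\phi|$ is absolutely continuous with respect to $|D^su|$. **Theorem 4.4.** Let $u$ be a bounded variation solution of (R). Assume that: - (l) there is $z\in(0,1)$ such that $f(x,u(x))\ge0$ for almost all $x\in(0,z)$ and $f(x,u(x))\le0$ for almost all $x\in(z,1)$; - (ll) there exist $\delta\in(0,1]$ and $\mu_0\in L^1(0,\delta)$ such that $f(x,u(x))\le\mu_0(x)$ for almost all $x\in(0,\delta)$, $M_0(x):=\int_0^x\mu_0(t)\,dt>0$ for all $x\in(0,\delta]$, and $\int_0^\delta\frac{dx}{\sqrt{M_0(x)}}=+\infty$; - (lll) there exist $\delta\in(0,1]$ and $\nu_1\in L^1(1-\delta,1)$ such that $f(x,u(x))\ge\nu_1(x)$ for almost all $x\in(1-\delta,1)$, $N_1(x):=\int_x^1\nu_1(t)\,dt<0$ for all $x\in[1-\delta,1)$, and $\int_{1-\delta}^1\frac{dx}{\sqrt{-N_1(x)}}=+\infty$; - (llll) either there exist $\delta\in(0,z]$ and $\mu_z\in L^1(z-\delta,z)$ such that $f(x,u(x))\le\mu_z(x)$ for almost all $x\in(z-\delta,z)$, $M_z(x):=\int_x^z\mu_z(t)\,dt>0$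 for all $x\in[z-\delta,z)$, and $\int_{z-\delta}^z\frac{dx}{\sqrt{M_z(x)}}=+\infty$; or there exist $\delta\in(0,1-z]$ and $\nu_z\in L^1(z,z+\delta)$ such that $f(x,u(x))\ge\nu_z(x)$ for almost all $x\in(z,z+\delta)$, $N_z(x):=\int_z^x\nu_z(t)\,dt<0$ for all $x\in(z,z+\delta]$, and $\int_z^{z+\delta}\frac{dx}{\sqrt{-N_z(x)}}=+\infty$. Then $u\in W^{2,1}(0,1)$ and (its representative in $C^1[0,1]$) satisfies the differential equation in (R) almost everywhere in $(0,1)$ as well as both boundary conditions in (R). -/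

import Mathlib

open MeasureTheory Set Filter Topology
open scoped ContDiff

noncomputable section

namespace PrescribedCurvature

/-- `φ` is a test function of class `C_c^∞(a, b)`. -/
structure IsTestFunction (a b : ℝ) (φ : ℝ → ℝ) : Prop where
  contDiff : ContDiff ℝ ∞ φ
  hasCompactSupport : HasCompactSupport φ
  tsupport_subset : tsupport φ ⊆ Ioo a b

/-! ### Functions of bounded variation on an interval

A function on `(a, b)` is represented by a function `ℝ → ℝ`; only its values almost everywhere in
`(a, b)` matter below. -/

/-- `v ∈ BV(a, b)` with derivative `Dv = ν`: `v ∈ L¹(a, b)` and its distributional derivative in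
`(a, b)` is the finite signed Radon measure `ν` (extended by zero outside `(a, b)`). -/
structure HasBVDeriv (a b : ℝ) (v : ℝ → ℝ) (ν : SignedMeasure ℝ) : Prop where
  integrableOn : IntegrableOn v (Ioo a b)
  restrict_eq : ν.restrict (Ioo a b) = ν
  integral_eq : ∀ φ : ℝ → ℝ, IsTestFunction a b φ →
    ∫ x in Ioo a b, v x * deriv φ x = - ∫ᵛ x, φ x ∂<•ν

/-- The density `D^a v` of the absolutely continuous part of the measure `Dv = ν`. -/
def acDensity (ν : SignedMeasure ℝ) : ℝ → ℝ := ν.rnDeriv volume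

/-- The singular part `D^s v` of the measure `Dv = ν`. -/
def singPart (ν : SignedMeasure ℝ) : SignedMeasure ℝ := ν.singularPart volume

/-- The density `σ / |σ|` of a signed measure `σ` with respect to its total variation. -/
def polarDensity (σ : SignedMeasure ℝ) : ℝ → ℝ := σ.rnDeriv σ.totalVariation

/-- The right trace `v(x₀⁺)`: the essential limit of `v` from the right at `x₀`. -/
def rightTrace (v : ℝ → ℝ) (x₀ : ℝ) : ℝ := limUnder (𝓝[>] x₀ ⊓ ae volume) v

/-- The left trace `v(x₀⁻)`: the essential limit of `v` from the left at `x₀`. -/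
def leftTrace (v : ℝ → ℝ) (x₀ : ℝ) : ℝ := limUnder (𝓝[<] x₀ ⊓ ae volume) v

/-- The function `s ↦ s / √(1 + s²)`. -/
def curvFlux (s : ℝ) : ℝ := s / √(1 + s ^ 2)

/-- `u ∈ BV(0, 1)` is a bounded variation solution of the Robin problem
`-(u' / √(1 + u'²))' = f(x, u)` in `(0, 1)`,
`u'(0) / √(1 + u'(0)²) + lam₀ u(0) = κ₀`, `u'(1) / √(1 + u'(1)²) + lam₁ u(1) = κ₁`. -/
def IsBVRobinSolution (f : ℝ → ℝ → ℝ) (lam₀ lam₁ κ₀ κ₁ : ℝ) (u : ℝ → ℝ) : Prop :=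
  IntegrableOn (fun x => f x (u x)) (Ioo 0 1) ∧
  ∃ Du : SignedMeasure ℝ, HasBVDeriv 0 1 u Du ∧
    ∀ (φ : ℝ → ℝ) (Dφ : SignedMeasure ℝ), HasBVDeriv 0 1 φ Dφ →
      (singPart Dφ).totalVariation ≪ (singPart Du).totalVariation →
      (∫ x in Ioo (0 : ℝ) 1, acDensity Du x * acDensity Dφ x / √(1 + acDensity Du x ^ 2))
          + (∫ᵛ x, polarDensity (singPart Du) x ∂<•(singPart Dφ))
          + (κ₀ - lam₀ * rightTrace u 0) * rightTrace φ 0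
          + (lam₁ * leftTrace u 1 - κ₁) * leftTrace φ 1
        = ∫ x in Ioo (0 : ℝ) 1, f x (u x) * φ x

/-! ### Sobolev functions -/

/-- `g ∈ L¹(a, b)` is the weak derivative in `(a, b)` of `v ∈ L¹(a, b)`. -/
structure HasWeakDeriv (a b : ℝ) (v g : ℝ → ℝ) : Prop where
  integrableOn : IntegrableOn v (Ioo a b)
  integrableOn_deriv : IntegrableOn g (Ioo a b)
  integral_eq : ∀ φ : ℝ → ℝ, IsTestFunction a b φ →
    ∫ x in Ioo a b, v x * deriv φ x = - ∫ x in Ioo a b, g x * φ x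

/-- `v ∈ W^{2,1}(a, b)`. -/
def MemW21 (a b : ℝ) (v : ℝ → ℝ) : Prop :=
  ∃ v₁ v₂ : ℝ → ℝ, HasWeakDeriv a b v v₁ ∧ HasWeakDeriv a b v₁ v₂

/-! ### One-sided controls on the decay to zero of a function `h` on `(0, 1)` at a point `c` -/

/-- There is a right neighbourhood `(c, c + δ)` of `c` in `(0, 1)` where `h ≤ μ`, with
`M(x) = ∫_c^x μ > 0` and `∫_c^{c+δ} 1/√M = +∞`. -/
def UpperDecayRight (h : ℝ → ℝ) (c : ℝ) : Prop :=
  ∃ δ : ℝ, 0 < δ ∧ c + δ ≤ 1 ∧ ∃ μ : ℝ → ℝ, IntegrableOn μ (Ioo c (c + δ)) ∧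
    (∀ᵐ x, x ∈ Ioo c (c + δ) → h x ≤ μ x) ∧
    (∀ x ∈ Ioc c (c + δ), 0 < ∫ t in c..x, μ t) ∧
    ∫⁻ x in Ioo c (c + δ), ENNReal.ofReal (1 / √(∫ t in c..x, μ t)) = ⊤

/-- There is a left neighbourhood `(c - δ, c)` of `c` in `(0, 1)` where `h ≤ μ`, with
`M(x) = ∫_x^c μ > 0` and `∫_{c-δ}^c 1/√M = +∞`. -/
def UpperDecayLeft (h : ℝ → ℝ) (c : ℝ) : Prop :=
  ∃ δ : ℝ, 0 < δ ∧ 0 ≤ c - δ ∧ ∃ μ : ℝ → ℝ, IntegrableOn μ (Ioo (c - δ) c) ∧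
    (∀ᵐ x, x ∈ Ioo (c - δ) c → h x ≤ μ x) ∧
    (∀ x ∈ Ico (c - δ) c, 0 < ∫ t in x..c, μ t) ∧
    ∫⁻ x in Ioo (c - δ) c, ENNReal.ofReal (1 / √(∫ t in x..c, μ t)) = ⊤

/-- There is a right neighbourhood `(c, c + δ)` of `c` in `(0, 1)` where `h ≥ ν`, with
`N(x) = ∫_c^x ν < 0` and `∫_c^{c+δ} 1/√(-N) = +∞`. -/
def LowerDecayRight (h : ℝ → ℝ) (c : ℝ) : Prop :=
  ∃ δ : ℝ, 0 < δ ∧ c + δ ≤ 1 ∧ ∃ ν : ℝ → ℝ, IntegrableOn ν (Ioo c (c + δ)) ∧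
    (∀ᵐ x, x ∈ Ioo c (c + δ) → ν x ≤ h x) ∧
    (∀ x ∈ Ioc c (c + δ), (∫ t in c..x, ν t) < 0) ∧
    ∫⁻ x in Ioo c (c + δ), ENNReal.ofReal (1 / √(-∫ t in c..x, ν t)) = ⊤

/-- There is a left neighbourhood `(c - δ, c)` of `c` in `(0, 1)` where `h ≥ ν`, with
`N(x) = ∫_x^c ν < 0` and `∫_{c-δ}^c 1/√(-N) = +∞`. -/
def LowerDecayLeft (h : ℝ → ℝ) (c : ℝ) : Prop :=
  ∃ δ : ℝ, 0 < δ ∧ 0 ≤ c - δ ∧ ∃ ν : ℝ → ℝ, IntegrableOn ν (Ioo (c - δ) c) ∧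
    (∀ᵐ x, x ∈ Ioo (c - δ) c → ν x ≤ h x) ∧
    (∀ x ∈ Ico (c - δ) c, (∫ t in x..c, ν t) < 0) ∧
    ∫⁻ x in Ioo (c - δ) c, ENNReal.ofReal (1 / √(-∫ t in x..c, ν t)) = ⊤

end PrescribedCurvature

end

open PrescribedCurvature

namespace PrescribedCurvature

/-! ### Integration against signed measures -/

/-! Write `h x = f x (u x)` and let `α`, `β` be the coefficients of the traces of `φ` at `0` and
`1`. Absolutely continuous test functions show that the flux of `D^a u` agrees a.e. with `w x =
∫_x^1 h - β` (`WeakEquation.curvFlux_ae_eq`). The constant test function gives `α + β = ∫_0^1 h`, so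
that `w 0 = α` and `w 1 = -β`.

The crux is `|w| < 1` on all of `[0, 1]` (`abs_flux_lt_one`). By the sign condition `w` decreases up
to `z` and increases afterwards, so only `w 0 < 1`, `w 1 < 1` and `w z > -1` are at stake. If, say,
`w 0 ≥ 1`, then `1 - |w x| ≤ w 0 - w x = ∫_0^x h ≤ M₀ x`. A flux within `m` of `±1` forces a slope
of order at least `1 / √m`, so `1 / √M₀ ≤ 2 (1 + |D^a u|)` would be integrable near `0`, against the
decay condition. The other two points are treated alike.

By compactness `|w| ≤ r < 1`. Testing with the primitive of `D^s u` yields `|D^s u|(ℝ) = ∫ w d(D^s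
u) ≤ r |D^s u|(ℝ)`, hence `D^s u = 0` (`WeakEquation.singPart_eq_zero`). So `u' = invCurvFlux w`,
and `invCurvFlux` is `C¹` on `[-r, r]` while `w` is absolutely continuous: this is the `W^{2,1}`
regularity (`memW21_of_flux`). The equation is `w' = -h`, and the boundary conditions are the
endpoint values of `w`. -/

theorem integrable_posPart {ν : SignedMeasure ℝ} {F : ℝ → ℝ} (hF : Integrable F ν.totalVariation) :
    Integrable F ν.toJordanDecomposition.posPart :=
  hF.mono_measure (Measure.le_add_right le_rfl)

theorem integrable_negPart {ν : SignedMeasure ℝ} {F : ℝ → ℝ} (hF : Integrable F ν.totalVariation) :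
    Integrable F ν.toJordanDecomposition.negPart :=
  hF.mono_measure (Measure.le_add_left le_rfl)

/-- The integral against a signed measure in terms of its Jordan decomposition. -/
theorem integral_signedMeasure_eq_sub (ν : SignedMeasure ℝ) {F : ℝ → ℝ}
    (hF : Integrable F ν.totalVariation) :
    ∫ᵛ x, F x ∂<•ν = (∫ x, F x ∂ν.toJordanDecomposition.posPart)
      - ∫ x, F x ∂ν.toJordanDecomposition.negPart := by
  conv_lhs => rw [← SignedMeasure.toSignedMeasure_toJordanDecomposition ν]
  rw [JordanDecomposition.toSignedMeasure, VectorMeasure.integral_sub_vectorMeasure,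
    VectorMeasure.integral_toSignedMeasure, VectorMeasure.integral_toSignedMeasure]
  · simpa [VectorMeasure.Integrable] using integrable_posPart hF
  · simpa [VectorMeasure.Integrable] using integrable_negPart hF

instance (ν : SignedMeasure ℝ) : IsFiniteMeasure ν.totalVariation := by
  unfold SignedMeasure.totalVariation; infer_instance

/-- Total variation commutes with restriction, and `|ν|`-null sets are `ν`-null. This turns the
concentration clause of `HasBVDeriv` into a null-set statement usable for a.e. arguments. -/
theorem restrict_eq_self_iff (ν : SignedMeasure ℝ) {s : Set ℝ} (hs : MeasurableSet s) :
    ν.restrict s = ν ↔ ν.totalVariation sᶜ = 0 := by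
  constructor
  · intro h
    rw [← h, SignedMeasure.totalVariation_eq_variation, VectorMeasure.variation_restrict hs,
      Measure.restrict_apply hs.compl]
    simp
  · intro h
    ext t ht
    rw [VectorMeasure.restrict_apply _ hs ht]
    have h0 : ν (t ∩ sᶜ) = 0 :=
      SignedMeasure.null_of_totalVariation_zero _ (measure_mono_null inter_subset_right h)
    have := VectorMeasure.of_union (v := ν) (A := t ∩ s) (B := t ∩ sᶜ)
      (by grind) (ht.inter hs) (ht.inter hs.compl)
    rw [inter_union_compl] at this
    rw [this, h0, add_zero]

theorem totalVariation_singPart_le (ν : SignedMeasure ℝ) :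
    (singPart ν).totalVariation ≤ ν.totalVariation := by
  rw [singPart, SignedMeasure.singularPart_totalVariation]
  exact add_le_add (Measure.singularPart_le _ _) (Measure.singularPart_le _ _)

theorem eq_zero_of_totalVariation_univ {ν : SignedMeasure ℝ} (h : ν.totalVariation univ = 0) :
    ν = 0 := by
  ext s _
  exact SignedMeasure.null_of_totalVariation_zero _ (measure_mono_null (subset_univ s) h)

/-- The polar density of a signed measure integrates to its total mass. -/
theorem integral_polarDensity (σ : SignedMeasure ℝ) :
    ∫ᵛ x, polarDensity σ x ∂<•σ = σ.totalVariation.real univ := by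
  rw [integral_signedMeasure_eq_sub (F := polarDensity σ) σ
    (SignedMeasure.integrable_rnDeriv _ _)]
  set P := σ.toJordanDecomposition.posPart with hP
  set N := σ.toJordanDecomposition.negPart with hN
  have hT : σ.totalVariation = P + N := rfl
  -- Hahn decomposition: the positive part lives on `sᶜ` and the negative part on `s`, so the polar
  -- density is `1` on the former and `-1` on the latter.
  obtain ⟨s, hs, hPs, hNs⟩ := σ.toJordanDecomposition.mutuallySingular
  rw [← hP] at hPs
  rw [← hN] at hNs
  have hPT : P = σ.totalVariation.restrict sᶜ := by
    rw [hT, Measure.restrict_add, Measure.restrict_eq_zero.2 hNs, add_zero,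
      Measure.restrict_eq_self_of_ae_mem]
    rw [ae_iff]; simpa using hPs
  have hNT : N = σ.totalVariation.restrict s := by
    rw [hT, Measure.restrict_add, Measure.restrict_eq_zero.2 hPs, zero_add,
      Measure.restrict_eq_self_of_ae_mem]
    rw [ae_iff]; exact hNs
  have hdP : P.rnDeriv σ.totalVariation =ᵐ[σ.totalVariation] sᶜ.indicator 1 := by
    conv_lhs => rw [hPT]
    exact Measure.rnDeriv_restrict_self _ hs.compl
  have hdN : N.rnDeriv σ.totalVariation =ᵐ[σ.totalVariation] s.indicator 1 := by
    conv_lhs => rw [hNT]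
    exact Measure.rnDeriv_restrict_self _ hs
  have hPle : P ≤ σ.totalVariation := Measure.le_add_right le_rfl
  have hNle : N ≤ σ.totalVariation := Measure.le_add_left le_rfl
  have e1 : ∫ x, polarDensity σ x ∂P = P.real univ := by
    have : polarDensity σ =ᵐ[P] fun _ => 1 := by
      have hmem : ∀ᵐ x ∂P, x ∉ s := by rw [ae_iff]; simpa using hPs
      filter_upwards [ae_mono hPle hdP, ae_mono hPle hdN, hmem] with x h1 h2 h3
      simp only [polarDensity, SignedMeasure.rnDeriv_def, ← hP, ← hN, h1, h2]
      simp [h3]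
    rw [integral_congr_ae this]; simp
  have e2 : ∫ x, polarDensity σ x ∂N = - N.real univ := by
    have : polarDensity σ =ᵐ[N] fun _ => -1 := by
      have hmem : ∀ᵐ x ∂N, x ∈ s := by rw [ae_iff]; exact hNs
      filter_upwards [ae_mono hNle hdP, ae_mono hNle hdN, hmem] with x h1 h2 h3
      simp only [polarDensity, SignedMeasure.rnDeriv_def, ← hP, ← hN, h1, h2]
      simp [h3]
    rw [integral_congr_ae this]; simp
  rw [e1, e2, hT, measureReal_add_apply]
  ring

/-! ### Primitives of measures -/

/-- Both sides are iterated integrals of `g x` over the region `t < x`. -/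
theorem integral_mul_measureReal_Iio (μ : Measure ℝ) [IsFiniteMeasure μ] {a b : ℝ}
    (hμ : μ (Ioo a b)ᶜ = 0) {g : ℝ → ℝ} (hg : IntegrableOn g (Ioo a b)) :
    ∫ x in Ioo a b, g x * μ.real (Iio x) = ∫ t, (∫ x in t..b, g x) ∂μ := by
  have hF : Integrable (Function.uncurry fun x t : ℝ => (Iio x).indicator (fun _ => g x) t)
      ((volume.restrict (Ioo a b)).prod μ) := by
    have h1 : Integrable (fun q : ℝ × ℝ => g q.1) ((volume.restrict (Ioo a b)).prod μ) :=
      Integrable.comp_fst hg μ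
    have h2 := h1.indicator (measurableSet_lt measurable_snd measurable_fst)
    refine h2.congr (Eventually.of_forall fun q => ?_)
    simp [indicator, Function.uncurry]
  have hswap := integral_integral_swap hF
  have hl : ∀ x, ∫ t, (Iio x).indicator (fun _ => g x) t ∂μ = g x * μ.real (Iio x) := by
    intro x
    rw [integral_indicator measurableSet_Iio]
    simp [mul_comm]
  simp_rw [hl] at hswap
  rw [hswap]
  refine integral_congr_ae ?_
  have hmem : ∀ᵐ t ∂μ, t ∈ Ioo a b := by rw [ae_iff]; exact hμ
  filter_upwards [hmem] with t ht
  rw [intervalIntegral.integral_of_le ht.2.le, integral_Ioc_eq_integral_Ioo]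
  have : (fun x => (Iio x).indicator (fun _ => g x) t) = (Ioi t).indicator g := by
    ext x; simp [indicator]
  rw [this, setIntegral_indicator measurableSet_Ioi]
  congr 2
  ext x; simp only [mem_inter_iff, mem_Ioo, mem_Ioi]
  exact ⟨fun h => ⟨h.2, h.1.2⟩, fun h => ⟨⟨ht.1.trans h.1, h.2⟩, h.1⟩⟩

/-- The primitive `x ↦ ν((-∞, x))` of a signed measure. -/
noncomputable def primitive (ν : SignedMeasure ℝ) (x : ℝ) : ℝ := ν (Iio x)

theorem primitive_eq_sub (ν : SignedMeasure ℝ) (x : ℝ) :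
    primitive ν x = ν.toJordanDecomposition.posPart.real (Iio x)
      - ν.toJordanDecomposition.negPart.real (Iio x) :=
  SignedMeasure.apply_eq_posPart_real_sub_negPart_real _ measurableSet_Iio

theorem integrableOn_mul_measureReal_Iio (μ : Measure ℝ) [IsFiniteMeasure μ] {s : Set ℝ}
    {g : ℝ → ℝ} (hg : IntegrableOn g s) : IntegrableOn (fun x => g x * μ.real (Iio x)) s := by
  have hm : Monotone fun x => μ.real (Iio x) := fun x y hxy =>
    measureReal_mono (Iio_subset_Iio hxy)
  refine Integrable.mul_bdd (c := μ.real univ) hg hm.measurable.aestronglyMeasurable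
    (Eventually.of_forall fun x => ?_)
  rw [Real.norm_of_nonneg measureReal_nonneg]
  exact measureReal_mono (subset_univ _)

theorem integrable_intervalIntegral_left (μ : Measure ℝ) [IsFiniteMeasure μ] {a b : ℝ}
    (hμ : μ (Ioo a b)ᶜ = 0) {g : ℝ → ℝ} (hg : IntegrableOn g (Ioo a b)) :
    Integrable (fun t => ∫ x in t..b, g x) μ := by
  have hmem : ∀ᵐ t ∂μ, t ∈ Ioo a b := by rw [ae_iff]; exact hμ
  -- Extension by zero makes the primitive continuous and bounded on the whole line, hence
  -- integrable for any finite measure.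
  have hg' : Integrable ((Ioo a b).indicator g) := hg.integrable_indicator measurableSet_Ioo
  have hc : Continuous fun t => ∫ x in t..b, (Ioo a b).indicator g x := by
    have := (intervalIntegral.continuous_primitive (fun _ _ => hg'.intervalIntegrable) b).neg
    refine this.congr fun t => ?_
    rw [intervalIntegral.integral_symm]; simp
  have hbd : ∀ t, ‖∫ x in t..b, (Ioo a b).indicator g x‖ ≤ ∫ x, ‖(Ioo a b).indicator g x‖ :=
    fun t => (intervalIntegral.norm_integral_le_integral_norm_uIoc).trans
      (setIntegral_le_integral hg'.norm (Eventually.of_forall fun _ => norm_nonneg _))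
  have hi : Integrable (fun t => ∫ x in t..b, (Ioo a b).indicator g x) μ :=
    Integrable.of_bound hc.aestronglyMeasurable _ (Eventually.of_forall hbd)
  refine hi.congr ?_
  filter_upwards [hmem] with t ht
  rw [intervalIntegral.integral_of_le ht.2.le, intervalIntegral.integral_of_le ht.2.le,
    integral_Ioc_eq_integral_Ioo, integral_Ioc_eq_integral_Ioo]
  refine setIntegral_congr_fun measurableSet_Ioo fun x hx => ?_
  simp [indicator, ht.1.trans hx.1, hx.2]

/-- Fubini's theorem for the primitive of a signed measure concentrated on `(a, b)`. -/
theorem integral_mul_primitive (ν : SignedMeasure ℝ) {a b : ℝ}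
    (hν : ν.restrict (Ioo a b) = ν) {g : ℝ → ℝ} (hg : IntegrableOn g (Ioo a b)) :
    ∫ x in Ioo a b, g x * primitive ν x = ∫ᵛ t, (∫ x in t..b, g x) ∂<•ν := by
  have h0 := (restrict_eq_self_iff ν measurableSet_Ioo).1 hν
  have hP : ν.toJordanDecomposition.posPart (Ioo a b)ᶜ = 0 :=
    nonpos_iff_eq_zero.1 (h0 ▸ Measure.le_add_right le_rfl (Ioo a b)ᶜ)
  have hN : ν.toJordanDecomposition.negPart (Ioo a b)ᶜ = 0 :=
    nonpos_iff_eq_zero.1 (h0 ▸ Measure.le_add_left le_rfl (Ioo a b)ᶜ)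
  rw [integral_signedMeasure_eq_sub ν (integrable_intervalIntegral_left _ h0 hg),
    ← integral_mul_measureReal_Iio _ hP hg, ← integral_mul_measureReal_Iio _ hN hg,
    ← integral_sub (integrableOn_mul_measureReal_Iio _ hg) (integrableOn_mul_measureReal_Iio _ hg)]
  simp_rw [primitive_eq_sub, mul_sub]

theorem integral_deriv_eq_neg {a b : ℝ} {φ : ℝ → ℝ} (hφ : IsTestFunction a b φ) (t : ℝ) :
    ∫ x in t..b, deriv φ x = - φ t := by
  have hb : φ b = 0 := by
    by_contra h
    exact absurd (hφ.tsupport_subset (subset_tsupport _ h)).2 (lt_irrefl _)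
  rw [intervalIntegral.integral_deriv_eq_sub, hb, zero_sub]
  · exact fun x _ => hφ.contDiff.differentiable (by simp) x
  · exact (hφ.contDiff.continuous_deriv (by simp)).intervalIntegrable _ _

theorem IsTestFunction.integrable_deriv {a b : ℝ} {φ : ℝ → ℝ} (hφ : IsTestFunction a b φ) :
    Integrable (deriv φ) :=
  (hφ.contDiff.continuous_deriv (by simp)).integrable_of_hasCompactSupport
    hφ.hasCompactSupport.deriv

/-- Fubini replaces `φ'` by `∫_t^b φ' = -φ t`. Test functions with a prescribed derivative are built
this way. -/
theorem hasBVDeriv_primitive (ν : SignedMeasure ℝ) {a b : ℝ}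
    (hν : ν.restrict (Ioo a b) = ν) : HasBVDeriv a b (primitive ν) ν where
  integrableOn := by
    have h1 : IntegrableOn (fun _ : ℝ => (1 : ℝ)) (Ioo a b) := by
      simp
    refine ((integrableOn_mul_measureReal_Iio ν.toJordanDecomposition.posPart h1).sub
      (integrableOn_mul_measureReal_Iio ν.toJordanDecomposition.negPart h1)).congr
      (Eventually.of_forall fun x => ?_)
    simp [primitive_eq_sub]
  restrict_eq := hν
  integral_eq φ hφ := by
    simp_rw [mul_comm (primitive ν _)]
    rw [integral_mul_primitive ν hν hφ.integrable_deriv.integrableOn]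
    simp_rw [integral_deriv_eq_neg hφ]
    exact VectorMeasure.integral_fun_neg _ _ _

/-! ### One-sided limits and essential traces -/

theorem tendsto_measureReal_Iio_nhdsGT (μ : Measure ℝ) [IsFiniteMeasure μ] (c : ℝ) :
    Tendsto (fun x => μ.real (Iio x)) (𝓝[>] c) (𝓝 (μ.real (Iic c))) := by
  simp_rw [← integral_indicator_one (μ := μ) (measurableSet_Iio),
    ← integral_indicator_one (μ := μ) (measurableSet_Iic)]
  refine tendsto_integral_filter_of_dominated_convergence (fun _ => 1)
    (Eventually.of_forall fun x => by measurability)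
    (Eventually.of_forall fun x => Eventually.of_forall fun t => ?_) (by simp)
    (Eventually.of_forall fun t => ?_)
  · by_cases h : t < x <;> simp [indicator, h]
  · apply tendsto_const_nhds.congr'
    -- The point `t = c` lies in `Iio x` for every `x > c`, so an atom at `c` is kept and the limit
    -- is the mass of `Iic c`.
    rcases le_or_gt t c with h | h
    · filter_upwards [self_mem_nhdsWithin] with x hx
      simp [indicator, h, h.trans_lt hx]
    · filter_upwards [Ioo_mem_nhdsGT h] with x hx
      simp [indicator, h.not_ge, hx.2.le]

theorem tendsto_measureReal_Iio_nhdsLT (μ : Measure ℝ) [IsFiniteMeasure μ] (c : ℝ) :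
    Tendsto (fun x => μ.real (Iio x)) (𝓝[<] c) (𝓝 (μ.real (Iio c))) := by
  simp_rw [← integral_indicator_one (μ := μ) (measurableSet_Iio)]
  refine tendsto_integral_filter_of_dominated_convergence (fun _ => 1)
    (Eventually.of_forall fun x => by measurability)
    (Eventually.of_forall fun x => Eventually.of_forall fun t => ?_) (by simp)
    (Eventually.of_forall fun t => ?_)
  · by_cases h : t < x <;> simp [indicator, h]
  · apply tendsto_const_nhds.congr'
    rcases le_or_gt c t with h | h
    · filter_upwards [self_mem_nhdsWithin] with x hx
      simp [indicator, h.not_gt, (lt_of_lt_of_le hx h).not_gt]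
    · filter_upwards [Ioo_mem_nhdsLT h] with x hx
      simp [indicator, h, hx.1]

/-- A one-sided neighbourhood has positive measure, so it meets every set of full measure. This
makes essential limits unique, so that `limUnder` returns the actual trace. -/
instance neBot_nhdsGT_inf_ae (c : ℝ) : NeBot (𝓝[>] c ⊓ ae (volume : Measure ℝ)) := by
  rw [inf_neBot_iff]
  intro s hs t ht
  obtain ⟨d, hd, hds⟩ := mem_nhdsGT_iff_exists_Ioo_subset.1 hs
  by_contra h
  have hsub : Ioo c d ⊆ tᶜ := fun x hx hxt => h ⟨x, hds hx, hxt⟩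
  have := measure_mono_null hsub (mem_ae_iff.1 ht)
  simp at this
  exact absurd hd (by simpa using this)

instance neBot_nhdsLT_inf_ae (c : ℝ) : NeBot (𝓝[<] c ⊓ ae (volume : Measure ℝ)) := by
  rw [inf_neBot_iff]
  intro s hs t ht
  obtain ⟨d, hd, hds⟩ := mem_nhdsLT_iff_exists_Ioo_subset.1 hs
  by_contra h
  have hsub : Ioo d c ⊆ tᶜ := fun x hx hxt => h ⟨x, hds hx, hxt⟩
  have := measure_mono_null hsub (mem_ae_iff.1 ht)
  simp at this
  exact absurd hd (by simpa using this)

theorem rightTrace_eq {v : ℝ → ℝ} {c l : ℝ} (h : Tendsto v (𝓝[>] c) (𝓝 l)) :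
    rightTrace v c = l :=
  (h.mono_left inf_le_left).limUnder_eq

theorem leftTrace_eq {v : ℝ → ℝ} {c l : ℝ} (h : Tendsto v (𝓝[<] c) (𝓝 l)) :
    leftTrace v c = l :=
  (h.mono_left inf_le_left).limUnder_eq

theorem rightTrace_congr {u v : ℝ → ℝ} {a b : ℝ} (hab : a < b)
    (h : ∀ᵐ x, x ∈ Ioo a b → u x = v x) : rightTrace u a = rightTrace v a := by
  have : u =ᶠ[𝓝[>] a ⊓ ae volume] v := by
    filter_upwards [mem_inf_of_right h, mem_inf_of_left (Ioo_mem_nhdsGT hab)] with x h1 h2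
    exact h1 h2
  rw [rightTrace, rightTrace, limUnder, limUnder, Filter.map_congr this]

theorem leftTrace_congr {u v : ℝ → ℝ} {a b : ℝ} (hab : a < b)
    (h : ∀ᵐ x, x ∈ Ioo a b → u x = v x) : leftTrace u b = leftTrace v b := by
  have : u =ᶠ[𝓝[<] b ⊓ ae volume] v := by
    filter_upwards [mem_inf_of_right h, mem_inf_of_left (Ioo_mem_nhdsLT hab)] with x h1 h2
    exact h1 h2
  rw [leftTrace, leftTrace, limUnder, limUnder, Filter.map_congr this]

/-- The measure has no mass on `Iic a`; in particular it has no atom at `a`. -/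
theorem rightTrace_primitive (ν : SignedMeasure ℝ) {a b : ℝ}
    (hν : ν.restrict (Ioo a b) = ν) : rightTrace (primitive ν) a = 0 := by
  refine rightTrace_eq ?_
  have h0 : ν (Iic a) = 0 := SignedMeasure.null_of_totalVariation_zero _
    (measure_mono_null (t := (Ioo a b)ᶜ) (fun x (hx : x ≤ a) h => absurd h.1 (not_lt.2 hx))
      ((restrict_eq_self_iff ν measurableSet_Ioo).1 hν))
  rw [← h0, SignedMeasure.apply_eq_posPart_real_sub_negPart_real _ measurableSet_Iic]
  exact ((tendsto_measureReal_Iio_nhdsGT _ a).sub (tendsto_measureReal_Iio_nhdsGT _ a)).congr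
    fun x => (primitive_eq_sub ν x).symm

theorem leftTrace_primitive (ν : SignedMeasure ℝ) {a b : ℝ}
    (hν : ν.restrict (Ioo a b) = ν) : leftTrace (primitive ν) b = ν univ := by
  refine leftTrace_eq ?_
  have h0 : ν univ = ν (Iio b) := by
    rw [← hν, VectorMeasure.restrict_apply _ measurableSet_Ioo MeasurableSet.univ,
      VectorMeasure.restrict_apply _ measurableSet_Ioo measurableSet_Iio, univ_inter,
      inter_eq_right.2 fun x hx => hx.2]
  rw [h0, SignedMeasure.apply_eq_posPart_real_sub_negPart_real _ measurableSet_Iio]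
  exact ((tendsto_measureReal_Iio_nhdsLT _ b).sub (tendsto_measureReal_Iio_nhdsLT _ b)).congr
    fun x => (primitive_eq_sub ν x).symm

end PrescribedCurvature

namespace PrescribedCurvature

/-! ### The flux `s ↦ s / √(1 + s²)` and its inverse -/

/-- The inverse `t ↦ t / √(1 - t²)` of `curvFlux`. -/
noncomputable def invCurvFlux (t : ℝ) : ℝ := t / √(1 - t ^ 2)

theorem invCurvFlux_curvFlux (s : ℝ) : invCurvFlux (curvFlux s) = s := by
  have h : 0 < 1 + s ^ 2 := by positivity
  have h1 : 1 - curvFlux s ^ 2 = (1 + s ^ 2)⁻¹ := by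
    rw [curvFlux, div_pow, Real.sq_sqrt h.le]; field_simp; ring
  rw [invCurvFlux, h1, Real.sqrt_inv, curvFlux]
  have := Real.sqrt_pos.2 h
  field_simp

theorem curvFlux_invCurvFlux {t : ℝ} (ht : |t| < 1) : curvFlux (invCurvFlux t) = t := by
  have h : 0 < 1 - t ^ 2 := by nlinarith [sq_lt_one_iff_abs_lt_one t |>.2 ht]
  have h1 : 1 + invCurvFlux t ^ 2 = (1 - t ^ 2)⁻¹ := by
    rw [invCurvFlux, div_pow, Real.sq_sqrt h.le]; field_simp; ring
  rw [curvFlux, h1, Real.sqrt_inv, invCurvFlux]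
  have := Real.sqrt_pos.2 h
  field_simp

theorem contDiffAt_invCurvFlux {t : ℝ} (ht : |t| < 1) : ContDiffAt ℝ 1 invCurvFlux t := by
  have h : 0 < 1 - t ^ 2 := by nlinarith [sq_lt_one_iff_abs_lt_one t |>.2 ht]
  unfold invCurvFlux
  refine contDiffAt_id.div ?_ (Real.sqrt_pos.2 h).ne'
  exact ContDiffAt.sqrt (by fun_prop) h.ne'

/-- A pointwise bound for the reciprocal square root of the defect `1 - |curvFlux s|`. -/
theorem one_div_sqrt_le_of_defect_le {s m : ℝ} (h : 1 - |curvFlux s| ≤ m) :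
    1 / √m ≤ 2 * (1 + |s|) := by
  have hs : 0 < 1 + s ^ 2 := by positivity
  have h1 : |curvFlux s| ^ 2 = 1 - (1 + s ^ 2)⁻¹ := by
    rw [sq_abs, curvFlux, div_pow, Real.sq_sqrt hs.le]; field_simp; ring
  have h2 : 0 < (1 + s ^ 2)⁻¹ := inv_pos.2 hs
  -- With `t = |curvFlux s|`, `(1 - t)² ≥ 0` gives `1 - t ≥ (1 - t²) / 2`, and `1 - t² = (1 +
  -- s²)⁻¹`.
  have h3 : (1 + s ^ 2)⁻¹ / 2 ≤ m := by
    nlinarith [abs_nonneg (curvFlux s), sq_nonneg (|curvFlux s| - 1)]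
  have h4 : (1 / (2 * (1 + |s|))) ^ 2 ≤ m := by
    refine le_trans ?_ h3
    rw [div_pow, one_pow, inv_eq_one_div, div_div]
    apply one_div_le_one_div_of_le (by positivity)
    nlinarith [abs_nonneg s, sq_abs s]
  have h5 : 1 / (2 * (1 + |s|)) ≤ √m := Real.le_sqrt_of_sq_le h4
  have h6 : 0 < 1 / (2 * (1 + |s|)) := by positivity
  calc 1 / √m ≤ 1 / (1 / (2 * (1 + |s|))) := one_div_le_one_div_of_le h6 h5
    _ = _ := by rw [one_div_one_div]

/-- The integrand is dominated by the integrable function `2 (1 + |a|)`. This is what collides with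
the divergent integrals in the decay conditions. -/
theorem lintegral_one_div_sqrt_ne_top {a M : ℝ → ℝ} {s : Set ℝ} (hs : volume s ≠ ⊤)
    (ha : IntegrableOn a s) (h : ∀ᵐ x ∂volume.restrict s, 1 - |curvFlux (a x)| ≤ M x) :
    ∫⁻ x in s, ENNReal.ofReal (1 / √(M x)) ≠ ⊤ := by
  have hi : IntegrableOn (fun x => 2 * (1 + |a x|)) s :=
    ((integrableOn_const hs).add ha.abs).const_mul 2
  refine ne_top_of_le_ne_top hi.lintegral_lt_top.ne (lintegral_mono_ae ?_)
  filter_upwards [h] with x hx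
  exact ENNReal.ofReal_le_ofReal (one_div_sqrt_le_of_defect_le hx)

/-! ### Absolutely continuous functions and weak derivatives -/

theorem absolutelyContinuousOnInterval_comp_of_lipschitzOnWith {G w : ℝ → ℝ} {a b : ℝ} {K : NNReal}
    {s : Set ℝ} (hG : LipschitzOnWith K G s) (hw : AbsolutelyContinuousOnInterval w a b)
    (hs : MapsTo w (uIcc a b) s) : AbsolutelyContinuousOnInterval (G ∘ w) a b := by
  rw [absolutelyContinuousOnInterval_iff] at hw ⊢
  intro ε hε
  -- `K + 1` rather than `K` also covers the Lipschitz constant `0`.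
  obtain ⟨δ, hδ, h⟩ := hw (ε / (K + 1)) (by positivity)
  refine ⟨δ, hδ, fun E hE hlt => ?_⟩
  calc ∑ i ∈ Finset.range E.1, dist ((G ∘ w) (E.2 i).1) ((G ∘ w) (E.2 i).2)
      ≤ ∑ i ∈ Finset.range E.1, K * dist (w (E.2 i).1) (w (E.2 i).2) :=
        Finset.sum_le_sum fun i hi =>
          hG.dist_le_mul _ (hs (hE.1 i hi).1) _ (hs (hE.1 i hi).2)
    _ = K * ∑ i ∈ Finset.range E.1, dist (w (E.2 i).1) (w (E.2 i).2) := by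
        rw [Finset.mul_sum]
    _ ≤ K * (ε / (K + 1)) := by gcongr; exact (h E hE hlt).le
    _ < (K + 1) * (ε / (K + 1)) := by gcongr; linarith
    _ = ε := by field

theorem hasWeakDeriv_of_absolutelyContinuous {F : ℝ → ℝ} {a b : ℝ} (hab : a ≤ b)
    (hF : AbsolutelyContinuousOnInterval F a b) : HasWeakDeriv a b F (deriv F) where
  integrableOn := by
    have := hF.continuousOn.integrableOn_compact (μ := volume) isCompact_uIcc
    rw [uIcc_of_le hab] at this
    exact this.mono_set Ioo_subset_Icc_self
  integrableOn_deriv := by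
    have := hF.intervalIntegrable_deriv
    rwa [intervalIntegrable_iff_integrableOn_Ioo_of_le hab] at this
  integral_eq φ hφ := by
    have hφa : AbsolutelyContinuousOnInterval φ a b :=
      ((hφ.contDiff.of_le (by simp)).contDiffOn).absolutelyContinuousOnInterval
    have h0 : ∀ x, x ∉ Ioo a b → φ x = 0 := fun x hx => by
      by_contra h
      exact hx (hφ.tsupport_subset (subset_tsupport _ h))
    have := hF.integral_mul_deriv_eq_deriv_mul hφa
    rw [h0 a (by simp), h0 b (by simp), intervalIntegral.integral_of_le hab,
      intervalIntegral.integral_of_le hab, integral_Ioc_eq_integral_Ioo,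
      integral_Ioc_eq_integral_Ioo] at this
    simpa using this

theorem HasWeakDeriv.congr {a b : ℝ} {u v g k : ℝ → ℝ} (h : HasWeakDeriv a b v g)
    (hu : ∀ᵐ x, x ∈ Ioo a b → u x = v x) (hk : ∀ᵐ x, x ∈ Ioo a b → k x = g x) :
    HasWeakDeriv a b u k := by
  have hu' : u =ᵐ[volume.restrict (Ioo a b)] v := (ae_restrict_iff' measurableSet_Ioo).2 hu
  have hk' : k =ᵐ[volume.restrict (Ioo a b)] g := (ae_restrict_iff' measurableSet_Ioo).2 hk
  refine ⟨h.integrableOn.congr hu'.symm, h.integrableOn_deriv.congr hk'.symm, fun φ hφ => ?_⟩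
  rw [integral_congr_ae (hu'.mono fun x hx => congrArg (· * deriv φ x) hx),
    integral_congr_ae (hk'.mono fun x hx => congrArg (· * φ x) hx)]
  exact h.integral_eq φ hφ

/-! ### The du Bois-Reymond lemma -/

theorem exists_isTestFunction_integral_eq_one {a b : ℝ} (hab : a < b) :
    ∃ ρ : ℝ → ℝ, IsTestFunction a b ρ ∧ ∫ x, ρ x = 1 := by
  let f : ContDiffBump ((a + b) / 2) := ⟨(b - a) / 8, (b - a) / 4, by linarith, by linarith⟩
  refine ⟨f.normed volume, ⟨f.contDiff_normed, f.hasCompactSupport_normed, ?_⟩,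
    f.integral_normed⟩
  rw [f.tsupport_normed_eq, Real.closedBall_eq_Icc]
  refine Icc_subset_Ioo ?_ ?_ <;> simp only [f] <;> linarith

theorem IsTestFunction.exists_Icc {a b : ℝ} (hab : a < b) {φ : ℝ → ℝ}
    (hφ : IsTestFunction a b φ) :
    ∃ c d, a < c ∧ c < d ∧ d < b ∧ ∀ x, x ∉ Icc c d → φ x = 0 := by
  -- The midpoint is added so that the compact set is nonempty even for `φ = 0`; moving the left end
  -- to `(a + c) / 2` below makes the interval nondegenerate.
  have hK : IsCompact (insert ((a + b) / 2) (tsupport φ)) := hφ.hasCompactSupport.isCompact.insert _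
  have hsub : insert ((a + b) / 2) (tsupport φ) ⊆ Ioo a b :=
    insert_subset ⟨by linarith, by linarith⟩ hφ.tsupport_subset
  obtain ⟨c, hc, hcl⟩ := hK.exists_isLeast (insert_nonempty _ _)
  obtain ⟨d, hd, hdl⟩ := hK.exists_isGreatest (insert_nonempty _ _)
  have hc' := hsub hc
  have hd' := hsub hd
  have hcd : c ≤ d := hcl hd
  refine ⟨(a + c) / 2, d, by linarith [hc'.1], by linarith [hc'.1], hd'.2, fun x hx => ?_⟩
  by_contra h
  have hx' : x ∈ insert ((a + b) / 2) (tsupport φ) := mem_insert_of_mem _ (subset_tsupport _ h)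
  exact hx ⟨by linarith [hcl hx', hc'.1], hdl hx'⟩

/-- A test function of zero mean is the derivative of a test function. -/
theorem IsTestFunction.exists_deriv_eq {a b : ℝ} (hab : a < b) {φ : ℝ → ℝ}
    (hφ : IsTestFunction a b φ) (h0 : ∫ x, φ x = 0) :
    ∃ ψ, IsTestFunction a b ψ ∧ deriv ψ = φ := by
  obtain ⟨c, d, hac, hcd, hdb, hz⟩ := hφ.exists_Icc hab
  have hder : ∀ x, HasDerivAt (fun x => ∫ t in c..x, φ t) (φ x) x := fun x =>
    (hφ.contDiff.continuous.integral_hasStrictDerivAt c x).hasDerivAt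
  have hderiv : deriv (fun x => ∫ t in c..x, φ t) = φ := funext fun x => (hder x).deriv
  have hzero : ∀ x, x ∉ Icc c d → ∫ t in c..x, φ t = 0 := by
    intro x hx
    rcases lt_or_ge x c with h | h
    · refine intervalIntegral.integral_zero_ae (Eventually.of_forall fun t ht => ?_)
      rw [uIoc_of_ge h.le] at ht
      rcases ht.2.lt_or_eq with h' | rfl
      · exact hz t fun hh => absurd hh.1 (not_le.2 h')
      -- At the endpoint `c` itself, `φ` vanishes by continuity from the left.
      · refine tendsto_nhds_unique (f := φ) (l := 𝓝[<] t)
          (hφ.contDiff.continuous.continuousWithinAt) ?_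
        refine tendsto_const_nhds.congr' ?_
        filter_upwards [self_mem_nhdsWithin] with y hy
        exact (hz y fun hh => absurd hh.1 (not_le.2 hy)).symm
    · have hd : d < x := by
        by_contra hh; exact hx ⟨h, not_lt.1 hh⟩
      rw [← h0, intervalIntegral.integral_of_le h]
      have hcompl : ∀ y, y ∉ Icc c x → φ y = 0 := fun y hy => hz y fun hh =>
        hy ⟨hh.1, hh.2.trans hd.le⟩
      rw [← integral_Icc_eq_integral_Ioc]
      exact setIntegral_eq_integral_of_forall_compl_eq_zero hcompl
  refine ⟨_, ⟨?_, ?_, ?_⟩, hderiv⟩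
  · refine contDiff_infty_iff_deriv.2 ⟨fun x => (hder x).differentiableAt, ?_⟩
    rw [hderiv]; exact hφ.contDiff
  · exact HasCompactSupport.intro isCompact_Icc hzero
  · refine (closure_minimal ?_ isClosed_Icc).trans (Icc_subset_Ioo hac hdb)
    intro x hx
    by_contra h
    exact hx (hzero x h)

theorem integrableOn_mul_testFunction {w φ : ℝ → ℝ} {a b c d : ℝ}
    (hw : IntegrableOn w (Ioo a b)) (hφ : IsTestFunction c d φ) :
    IntegrableOn (fun x => w x * φ x) (Ioo a b) := by
  obtain ⟨C, hC⟩ := hφ.hasCompactSupport.exists_bound_of_continuous hφ.contDiff.continuous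
  exact Integrable.mul_bdd hw hφ.contDiff.continuous.aestronglyMeasurable (Eventually.of_forall hC)

theorem setIntegral_testFunction {a b : ℝ} {φ : ℝ → ℝ} (hφ : IsTestFunction a b φ) (w : ℝ → ℝ) :
    ∫ x in Ioo a b, w x * φ x = ∫ x, w x * φ x :=
  setIntegral_eq_integral_of_forall_compl_eq_zero fun x hx => by
    have : φ x = 0 := by
      by_contra h
      exact hx (hφ.tsupport_subset (subset_tsupport _ h))
    rw [this, mul_zero]

theorem IsTestFunction.sub_const_mul {a b : ℝ} {φ ρ : ℝ → ℝ} (hφ : IsTestFunction a b φ)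
    (hρ : IsTestFunction a b ρ) (m : ℝ) : IsTestFunction a b (fun x => φ x - m * ρ x) where
  contDiff := hφ.contDiff.sub (contDiff_const.mul hρ.contDiff)
  hasCompactSupport := hφ.hasCompactSupport.sub hρ.hasCompactSupport.mul_left
  tsupport_subset := by
    refine (tsupport_sub _ _).trans (union_subset hφ.tsupport_subset ?_)
    exact (tsupport_mul_subset_right (f := fun _ => m)).trans hρ.tsupport_subset

/-- An integrable function on `(a, b)` with zero distributional derivative is constant. -/
theorem exists_ae_eq_const_of_integral_mul_deriv_eq_zero {a b : ℝ} (hab : a < b) {w : ℝ → ℝ}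
    (hw : IntegrableOn w (Ioo a b))
    (h : ∀ ψ, IsTestFunction a b ψ → ∫ x in Ioo a b, w x * deriv ψ x = 0) :
    ∃ C, ∀ᵐ x, x ∈ Ioo a b → w x = C := by
  obtain ⟨ρ, hρ, hρ1⟩ := exists_isTestFunction_integral_eq_one hab
  refine ⟨∫ x in Ioo a b, w x * ρ x, ?_⟩
  set C := ∫ x in Ioo a b, w x * ρ x with hC
  have hc : IntegrableOn (fun _ : ℝ => C) (Ioo a b) := by simp
  have key := IsOpen.ae_eq_zero_of_integral_contDiff_smul_eq_zero (μ := volume)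
    (f := fun x => w x - C) (isOpen_Ioo (a := a) (b := b)) (hw.sub hc).locallyIntegrableOn ?_
  · filter_upwards [key] with x hx hxm
    exact sub_eq_zero.1 (hx hxm)
  intro φ h1 h2 h3
  have hφ : IsTestFunction a b φ := ⟨h1, h2, h3⟩
  set m := ∫ x, φ x with hm
  have hφi : Integrable φ := h1.continuous.integrable_of_hasCompactSupport h2
  have hρi : Integrable ρ := hρ.contDiff.continuous.integrable_of_hasCompactSupport
    hρ.hasCompactSupport
  -- `φ - m ρ` has mean zero, hence is some `ψ'`; the hypothesis then gives `∫ w φ = m C = ∫ C φ`.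
  obtain ⟨ψ, hψ, hψd⟩ := (hφ.sub_const_mul hρ m).exists_deriv_eq hab (by
    rw [integral_sub hφi (hρi.const_mul m), integral_const_mul, hρ1, ← hm]; ring)
  have e := h ψ hψ
  simp_rw [hψd, mul_sub, mul_left_comm _ m] at e
  rw [integral_sub (integrableOn_mul_testFunction hw hφ)
    ((integrableOn_mul_testFunction hw hρ).const_mul m), integral_const_mul, ← hC] at e
  have e2 : ∫ x in Ioo a b, (w x - C) * φ x = 0 := by
    simp_rw [sub_mul]
    rw [integral_sub (integrableOn_mul_testFunction hw hφ) (hφi.integrableOn.const_mul C),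
      integral_const_mul]
    have : ∫ x in Ioo a b, φ x = m := by
      simpa using setIntegral_testFunction hφ (fun _ => 1)
    rw [this]; linarith
  rw [setIntegral_testFunction hφ] at e2
  simpa [mul_comm] using e2

end PrescribedCurvature

namespace PrescribedCurvature

/-! ### The weak formulation -/

/-- The weak equation `-(curvFlux u')' = h` for a function with derivative `Du`, tested with all
`φ ∈ BV(0, 1)` whose singular part is controlled by that of `Du`; `α` and `β` are the coefficients
of the boundary terms. -/
def WeakEquation (Du : SignedMeasure ℝ) (h : ℝ → ℝ) (α β : ℝ) : Prop :=
  ∀ (φ : ℝ → ℝ) (Dφ : SignedMeasure ℝ), HasBVDeriv 0 1 φ Dφ →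
    (singPart Dφ).totalVariation ≪ (singPart Du).totalVariation →
    (∫ x in Ioo (0 : ℝ) 1, acDensity Du x * acDensity Dφ x / √(1 + acDensity Du x ^ 2))
        + (∫ᵛ x, polarDensity (singPart Du) x ∂<•(singPart Dφ))
        + α * rightTrace φ 0 + β * leftTrace φ 1
      = ∫ x in Ioo (0 : ℝ) 1, h x * φ x

/-- Here, and in the next three lemmas, the reason is uniqueness of the Lebesgue decomposition. -/
theorem singPart_withDensity (f : ℝ → ℝ) : singPart (volume.withDensityᵥ f) = 0 :=
  (SignedMeasure.eq_singularPart 0 f VectorMeasure.MutuallySingular.zero_left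
    (zero_add _).symm).symm

theorem acDensity_withDensity {f : ℝ → ℝ} (hf : Integrable f) :
    acDensity (volume.withDensityᵥ f) =ᵐ[volume] f :=
  (SignedMeasure.eq_rnDeriv 0 f hf VectorMeasure.MutuallySingular.zero_left
    (zero_add _).symm).symm

theorem singPart_singPart (ν : SignedMeasure ℝ) : singPart (singPart ν) = singPart ν :=
  (SignedMeasure.eq_singularPart _ 0 (SignedMeasure.mutuallySingular_singularPart ν volume)
    (by rw [withDensityᵥ_zero, add_zero]; rfl)).symm

theorem acDensity_singPart (ν : SignedMeasure ℝ) : acDensity (singPart ν) =ᵐ[volume] 0 :=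
  (SignedMeasure.eq_rnDeriv _ 0 (integrable_zero _ _ _)
    (SignedMeasure.mutuallySingular_singularPart ν volume)
    (by rw [withDensityᵥ_zero, add_zero]; rfl)).symm

/-- An absolutely continuous `Dφ` is always admissible and removes the singular term. -/
theorem WeakEquation.integral_mul_curvFlux {Du : SignedMeasure ℝ} {h : ℝ → ℝ} {α β : ℝ}
    (hw : WeakEquation Du h α β) {φ f : ℝ → ℝ} (hf : Integrable f)
    (hφ : HasBVDeriv 0 1 φ (volume.withDensityᵥ f)) :
    (∫ x in Ioo (0 : ℝ) 1, f x * curvFlux (acDensity Du x))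
        + α * rightTrace φ 0 + β * leftTrace φ 1
      = ∫ x in Ioo (0 : ℝ) 1, h x * φ x := by
  have := hw φ _ hφ (by rw [singPart_withDensity, SignedMeasure.totalVariation_zero]
                        exact Measure.AbsolutelyContinuous.zero _)
  rw [singPart_withDensity, VectorMeasure.integral_zero_vectorMeasure, add_zero] at this
  rw [← this]
  congr 2
  refine integral_congr_ae (ae_restrict_of_ae ?_)
  filter_upwards [acDensity_withDensity hf] with x hx
  rw [hx, curvFlux]; ring

/-- Test with the constant `1`. This identifies the value at `0` of the flux normalised at `1`. -/
theorem WeakEquation.boundary_add {Du : SignedMeasure ℝ} {h : ℝ → ℝ} {α β : ℝ}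
    (hw : WeakEquation Du h α β) : α + β = ∫ x in (0 : ℝ)..1, h x := by
  have hφ : HasBVDeriv 0 1 (fun _ => 1) (volume.withDensityᵥ (0 : ℝ → ℝ)) := by
    rw [withDensityᵥ_zero]
    refine ⟨by simp, by simp, fun φ hφ => ?_⟩
    have h0 : φ 0 = 0 := by
      by_contra h
      exact absurd (hφ.tsupport_subset (subset_tsupport _ h)).1 (lt_irrefl _)
    have := integral_deriv_eq_neg hφ 0
    rw [intervalIntegral.integral_of_le zero_le_one, integral_Ioc_eq_integral_Ioo, h0] at this
    simpa using this
  have := hw.integral_mul_curvFlux (integrable_zero _ _ _) hφ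
  rw [rightTrace_eq (l := 1) tendsto_const_nhds, leftTrace_eq (l := 1) tendsto_const_nhds] at this
  rw [intervalIntegral.integral_of_le zero_le_one, integral_Ioc_eq_integral_Ioo]
  simpa using this

theorem acDensity_integrable (ν : SignedMeasure ℝ) : Integrable (acDensity ν) :=
  SignedMeasure.integrable_rnDeriv _ _

theorem abs_curvFlux_lt_one (s : ℝ) : |curvFlux s| < 1 := by
  have h : 0 < 1 + s ^ 2 := by positivity
  rw [curvFlux, abs_div, abs_of_pos (Real.sqrt_pos.2 h), div_lt_one (Real.sqrt_pos.2 h)]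
  exact Real.lt_sqrt_of_sq_lt (by rw [sq_abs]; linarith)

theorem integrableOn_curvFlux_acDensity (ν : SignedMeasure ℝ) :
    IntegrableOn (fun x => curvFlux (acDensity ν x)) (Ioo 0 1) := by
  have hm : Measurable (acDensity ν) := SignedMeasure.measurable_rnDeriv _ _
  have : Measurable fun x => curvFlux (acDensity ν x) := by
    unfold curvFlux; fun_prop
  exact Integrable.of_bound this.aestronglyMeasurable 1
    (Eventually.of_forall fun x => (abs_curvFlux_lt_one _).le)

/-- The absolutely continuous part of the flux is a primitive of `-h`. -/
theorem WeakEquation.curvFlux_ae_eq {Du : SignedMeasure ℝ} {h : ℝ → ℝ} {α β : ℝ}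
    (hw : WeakEquation Du h α β) (hh : IntegrableOn h (Ioo 0 1)) :
    ∀ᵐ x, x ∈ Ioo (0 : ℝ) 1 → curvFlux (acDensity Du x) = (∫ t in x..1, h t) - β := by
  have hHi : IntegrableOn (fun x => ∫ t in x..1, h t) (Ioo 0 1) :=
    integrable_intervalIntegral_left (volume.restrict (Ioo (0 : ℝ) 1))
      (by rw [Measure.restrict_apply measurableSet_Ioo.compl]; simp) hh
  rw [← ae_restrict_iff' measurableSet_Ioo]
  refine Integrable.ae_eq_of_forall_setIntegral_eq _ _ (integrableOn_curvFlux_acDensity Du)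
    (hHi.sub (by simp : IntegrableOn (fun _ : ℝ => β) (Ioo 0 1))) fun t ht _ => ?_
  rw [Measure.restrict_restrict ht]
  set s := t ∩ Ioo (0 : ℝ) 1 with hs
  have hsm : MeasurableSet s := ht.inter measurableSet_Ioo
  have hsub : s ⊆ Ioo (0 : ℝ) 1 := inter_subset_right
  have hfin : volume s ≠ ⊤ := ne_top_of_le_ne_top (by simp) (measure_mono hsub)
  have hfact : IsFiniteMeasure (volume.restrict s) := ⟨by simpa using hfin.lt_top⟩
  have hi : Integrable (s.indicator (1 : ℝ → ℝ)) :=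
    (integrableOn_const hfin).integrable_indicator hsm
  -- The test function is the primitive of Lebesgue measure on `s`: its traces are `0` and `|s|`,
  -- and Fubini turns the right-hand side into `∫_s ∫_x^1 h`.
  have hν : (volume.restrict s).toSignedMeasure = volume.withDensityᵥ (s.indicator 1) := by
    ext r hr
    rw [Measure.toSignedMeasure_apply_measurable hr, withDensityᵥ_apply hi hr,
      setIntegral_indicator hsm, measureReal_restrict_apply hr]
    simp
  have hres : (volume.restrict s).toSignedMeasure.restrict (Ioo (0 : ℝ) 1)
      = (volume.restrict s).toSignedMeasure := by
    rw [restrict_eq_self_iff _ measurableSet_Ioo, SignedMeasure.totalVariation_eq_variation,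
      Measure.variation_toSignedMeasure, Measure.restrict_apply measurableSet_Ioo.compl]
    have : (Ioo (0 : ℝ) 1)ᶜ ∩ s = ∅ := by
      rw [← disjoint_iff_inter_eq_empty]
      exact (disjoint_compl_left_iff_subset).2 hsub
    simp [this]
  have hφ := hasBVDeriv_primitive _ hres
  have e := hw.integral_mul_curvFlux hi (hν ▸ hφ)
  rw [← hν, rightTrace_primitive _ hres, leftTrace_primitive _ hres,
    integral_mul_primitive _ hres hh, VectorMeasure.integral_toSignedMeasure,
    Measure.toSignedMeasure_apply_measurable MeasurableSet.univ] at e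
  have e1 : ∫ x in Ioo (0 : ℝ) 1, s.indicator (1 : ℝ → ℝ) x * curvFlux (acDensity Du x)
      = ∫ x in s, curvFlux (acDensity Du x) := by
    have : (fun x => s.indicator (1 : ℝ → ℝ) x * curvFlux (acDensity Du x))
        = s.indicator fun x => curvFlux (acDensity Du x) := by
      ext x; by_cases hx : x ∈ s <;> simp [hx]
    rw [this, setIntegral_indicator hsm, inter_eq_right.2 hsub]
  rw [e1] at e
  rw [integral_sub (hHi.mono_set hsub) (integrableOn_const hfin), ← e]
  simp [mul_comm β]

/-- If the flux stays strictly below `1` in absolute value, the singular part vanishes. -/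
theorem WeakEquation.singPart_eq_zero {Du : SignedMeasure ℝ} {h : ℝ → ℝ} {α β r : ℝ}
    (hw : WeakEquation Du h α β) (hh : IntegrableOn h (Ioo 0 1))
    (hDu : Du.restrict (Ioo 0 1) = Du) (hr : r < 1)
    (hlt : ∀ x ∈ Ioo (0 : ℝ) 1, |(∫ t in x..1, h t) - β| ≤ r) : singPart Du = 0 := by
  set σ := singPart Du with hσ
  have h0 : σ.totalVariation (Ioo (0 : ℝ) 1)ᶜ = 0 :=
    nonpos_iff_eq_zero.1 ((totalVariation_singPart_le Du _).trans_eq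
      ((restrict_eq_self_iff Du measurableSet_Ioo).1 hDu))
  have hres : σ.restrict (Ioo 0 1) = σ := (restrict_eq_self_iff σ measurableSet_Ioo).2 h0
  -- The primitive of `D^s u` is admissible, and its singular term is the full mass of `|D^s u|`.
  have e := hw _ _ (hasBVDeriv_primitive σ hres) (by
    rw [hσ, singPart_singPart])
  have e1 : ∫ x in Ioo (0 : ℝ) 1,
      acDensity Du x * acDensity σ x / √(1 + acDensity Du x ^ 2) = 0 := by
    refine integral_eq_zero_of_ae (ae_restrict_of_ae ?_)
    filter_upwards [acDensity_singPart Du] with x hx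
    simp [hσ, hx]
  have hs : singPart σ = σ := singPart_singPart Du
  rw [e1, ← hσ, hs, integral_polarDensity, rightTrace_primitive _ hres,
    leftTrace_primitive _ hres, integral_mul_primitive _ hres hh] at e
  have hv : σ.variation = σ.totalVariation := (SignedMeasure.totalVariation_eq_variation σ).symm
  have : IsFiniteMeasure σ.variation := by rw [hv]; infer_instance
  have hHi : σ.Integrable fun x => ∫ t in x..1, h t := by
    rw [VectorMeasure.Integrable, hv]
    exact integrable_intervalIntegral_left _ h0 hh
  have e2 : ∫ᵛ x, ((∫ t in x..1, h t) - β) ∂<•σ = σ.totalVariation.real univ := by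
    rw [VectorMeasure.integral_fun_sub hHi (integrable_const β), ← e,
      VectorMeasure.integral_const]
    simp [mul_comm β]
  have hb : ∀ᵐ x ∂σ.variation, ‖(∫ t in x..1, h t) - β‖ ≤ r := by
    have hmem : ∀ᵐ t ∂σ.variation, t ∈ Ioo (0 : ℝ) 1 := by rw [ae_iff, hv]; exact h0
    filter_upwards [hmem] with x hx using hlt x hx
  have hle := VectorMeasure.norm_integral_le_of_norm_le_const
    (B := (ContinuousLinearMap.lsmul ℝ ℝ (E := ℝ)).flip) hb
  rw [e2, hv, Real.norm_of_nonneg measureReal_nonneg] at hle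
  have hB : ‖(ContinuousLinearMap.lsmul ℝ ℝ (E := ℝ)).flip‖ = 1 := by
    rw [ContinuousLinearMap.opNorm_flip]; simp
  rw [hB, mul_one] at hle
  -- The mass is at most `r` times itself with `r < 1`.
  have hz : σ.totalVariation.real univ = 0 := by
    nlinarith [measureReal_nonneg (μ := σ.totalVariation) (s := univ)]
  refine eq_zero_of_totalVariation_univ ?_
  simpa [measureReal_def, ENNReal.toReal_eq_zero_iff] using hz

end PrescribedCurvature

namespace PrescribedCurvature

/-! ### Consequences of the decay conditions -/

/-- Since `h ≤ μ`, the defect of the flux would be at most `M`, making `1 / √M` integrable. -/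
theorem UpperDecayRight.not_defect_le {h a : ℝ → ℝ} {c : ℝ} (hd : UpperDecayRight h c)
    (hc : 0 ≤ c) (hh : IntegrableOn h (Ioo 0 1)) (ha : Integrable a)
    (hw : ∀ᵐ x, x ∈ Ioo (0 : ℝ) 1 → c < x → 1 - |curvFlux (a x)| ≤ ∫ t in c..x, h t) : False := by
  obtain ⟨δ, -, hδ1, μ, hμ, hle, -, htop⟩ := hd
  refine lintegral_one_div_sqrt_ne_top (by simp) ha.integrableOn ?_ htop
  rw [ae_restrict_iff' measurableSet_Ioo]
  filter_upwards [hw] with x hx hxm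
  have hsub : Ioo c x ⊆ Ioo c (c + δ) := Ioo_subset_Ioo_right hxm.2.le
  have hsub' : Ioo c x ⊆ Ioo 0 1 := Ioo_subset_Ioo hc (hxm.2.le.trans hδ1)
  refine (hx ⟨hc.trans_lt hxm.1, hxm.2.trans_le hδ1⟩ hxm.1).trans ?_
  rw [intervalIntegral.integral_of_le hxm.1.le, intervalIntegral.integral_of_le hxm.1.le,
    integral_Ioc_eq_integral_Ioo, integral_Ioc_eq_integral_Ioo]
  refine integral_mono_ae (hh.mono_set hsub') (hμ.mono_set hsub) ?_
  rw [EventuallyLE, ae_restrict_iff' measurableSet_Ioo]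
  filter_upwards [hle] with t ht htm using ht (hsub htm)

theorem UpperDecayLeft.not_defect_le {h a : ℝ → ℝ} {c : ℝ} (hd : UpperDecayLeft h c)
    (hc : c ≤ 1) (hh : IntegrableOn h (Ioo 0 1)) (ha : Integrable a)
    (hw : ∀ᵐ x, x ∈ Ioo (0 : ℝ) 1 → x < c → 1 - |curvFlux (a x)| ≤ ∫ t in x..c, h t) : False := by
  obtain ⟨δ, -, hδ1, μ, hμ, hle, -, htop⟩ := hd
  refine lintegral_one_div_sqrt_ne_top (by simp) ha.integrableOn ?_ htop
  rw [ae_restrict_iff' measurableSet_Ioo]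
  filter_upwards [hw] with x hx hxm
  have hsub : Ioo x c ⊆ Ioo (c - δ) c := Ioo_subset_Ioo_left hxm.1.le
  have hsub' : Ioo x c ⊆ Ioo 0 1 := Ioo_subset_Ioo (hδ1.trans hxm.1.le) hc
  refine (hx ⟨hδ1.trans_lt hxm.1, hxm.2.trans_le hc⟩ hxm.2).trans ?_
  rw [intervalIntegral.integral_of_le hxm.2.le, intervalIntegral.integral_of_le hxm.2.le,
    integral_Ioc_eq_integral_Ioo, integral_Ioc_eq_integral_Ioo]
  refine integral_mono_ae (hh.mono_set hsub') (hμ.mono_set hsub) ?_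
  rw [EventuallyLE, ae_restrict_iff' measurableSet_Ioo]
  filter_upwards [hle] with t ht htm using ht (hsub htm)

/-- Passing to `-h` reduces the lower conditions to the contradiction already available for the
upper ones. -/
theorem LowerDecayRight.neg {h : ℝ → ℝ} {c : ℝ} (hd : LowerDecayRight h c) :
    UpperDecayRight (fun x => -h x) c := by
  obtain ⟨δ, hδ, hδ1, ν, hν, hle, hlt, htop⟩ := hd
  refine ⟨δ, hδ, hδ1, fun x => -ν x, hν.neg, ?_, fun x hx => ?_, ?_⟩
  · filter_upwards [hle] with x hx hxm using neg_le_neg (hx hxm)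
  · rw [intervalIntegral.integral_neg]; exact neg_pos.2 (hlt x hx)
  · simpa only [intervalIntegral.integral_neg] using htop

theorem LowerDecayLeft.neg {h : ℝ → ℝ} {c : ℝ} (hd : LowerDecayLeft h c) :
    UpperDecayLeft (fun x => -h x) c := by
  obtain ⟨δ, hδ, hδ1, ν, hν, hle, hlt, htop⟩ := hd
  refine ⟨δ, hδ, hδ1, fun x => -ν x, hν.neg, ?_, fun x hx => ?_, ?_⟩
  · filter_upwards [hle] with x hx hxm using neg_le_neg (hx hxm)
  · rw [intervalIntegral.integral_neg]; exact neg_pos.2 (hlt x hx)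
  · simpa only [intervalIntegral.integral_neg] using htop

/-- Under the sign and decay conditions, the flux stays in `(-1, 1)` up to the boundary. -/
theorem abs_flux_lt_one {h w a : ℝ → ℝ} {z : ℝ} (hh : IntegrableOn h (Ioo 0 1))
    (ha : Integrable a) (hwa : ∀ᵐ x, x ∈ Ioo (0 : ℝ) 1 → curvFlux (a x) = w x)
    (hw : ∀ s ∈ Icc (0 : ℝ) 1, ∀ t ∈ Icc (0 : ℝ) 1, w s - w t = ∫ x in s..t, h x)
    (hz : z ∈ Ioo (0 : ℝ) 1)
    (hpos : ∀ᵐ x : ℝ, x ∈ Ioo 0 z → 0 ≤ h x) (hneg : ∀ᵐ x : ℝ, x ∈ Ioo z 1 → h x ≤ 0)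
    (h₀ : UpperDecayRight h 0) (h₁ : LowerDecayLeft h 1)
    (h_z : UpperDecayLeft h z ∨ LowerDecayRight h z) :
    ∀ x ∈ Icc (0 : ℝ) 1, |w x| < 1 := by
  have m0 : (0 : ℝ) ∈ Icc (0 : ℝ) 1 := by simp
  have m1 : (1 : ℝ) ∈ Icc (0 : ℝ) 1 := by simp
  have mz : z ∈ Icc (0 : ℝ) 1 := Ioo_subset_Icc_self hz
  -- If `w 0 ≥ 1`, then `1 - |w x| ≤ w 0 - w x = ∫_0^x h`, which the decay at `0` excludes. The same
  -- comparison with `w 1`, and with `-w z`, gives the next two bounds.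
  have w0 : w 0 < 1 := by
    by_contra! hge
    refine h₀.not_defect_le le_rfl hh ha ?_
    filter_upwards [hwa] with x hx hxm _
    rw [hx hxm, ← hw 0 m0 x (Ioo_subset_Icc_self hxm)]
    linarith [le_abs_self (w x)]
  have w1 : w 1 < 1 := by
    by_contra! hge
    refine h₁.neg.not_defect_le le_rfl hh.neg ha ?_
    filter_upwards [hwa] with x hx hxm _
    rw [hx hxm, intervalIntegral.integral_neg, ← hw x (Ioo_subset_Icc_self hxm) 1 m1]
    linarith [le_abs_self (w x)]
  have wz : -1 < w z := by
    by_contra! hge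
    rcases h_z with h_z | h_z
    · refine h_z.not_defect_le hz.2.le hh ha ?_
      filter_upwards [hwa] with x hx hxm _
      rw [hx hxm, ← hw x (Ioo_subset_Icc_self hxm) z mz]
      linarith [neg_abs_le (w x)]
    · refine h_z.neg.not_defect_le hz.1.le hh.neg ha ?_
      filter_upwards [hwa] with x hx hxm _
      rw [hx hxm, intervalIntegral.integral_neg, ← hw z mz x (Ioo_subset_Icc_self hxm)]
      linarith [neg_abs_le (w x)]
  have anti : ∀ s ∈ Icc (0 : ℝ) z, ∀ t ∈ Icc (0 : ℝ) z, s ≤ t → w t ≤ w s := by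
    intro s hs t ht hst
    have e := hw s ⟨hs.1, hs.2.trans mz.2⟩ t ⟨ht.1, ht.2.trans mz.2⟩
    have : 0 ≤ ∫ x in s..t, h x := by
      rw [intervalIntegral.integral_of_le hst, integral_Ioc_eq_integral_Ioo]
      refine integral_nonneg_of_ae ((ae_restrict_iff' measurableSet_Ioo).2 ?_)
      filter_upwards [hpos] with x hx hxm
        using hx ⟨hs.1.trans_lt hxm.1, hxm.2.trans_le ht.2⟩
    linarith
  have mono : ∀ s ∈ Icc z 1, ∀ t ∈ Icc z 1, s ≤ t → w s ≤ w t := by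
    intro s hs t ht hst
    have e := hw s ⟨mz.1.trans hs.1, hs.2⟩ t ⟨mz.1.trans ht.1, ht.2⟩
    have : ∫ x in s..t, h x ≤ 0 := by
      rw [intervalIntegral.integral_of_le hst, integral_Ioc_eq_integral_Ioo]
      refine integral_nonpos_of_ae ((ae_restrict_iff' measurableSet_Ioo).2 ?_)
      filter_upwards [hneg] with x hx hxm
        using hx ⟨hs.1.trans_lt hxm.1, hxm.2.trans_le ht.2⟩
    linarith
  intro x hx
  rw [abs_lt]
  rcases le_total x z with hxz | hxz
  · exact ⟨wz.trans_le (anti x ⟨hx.1, hxz⟩ z ⟨mz.1, le_rfl⟩ hxz),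
      (anti 0 ⟨le_rfl, mz.1⟩ x ⟨hx.1, hxz⟩ hx.1).trans_lt w0⟩
  · exact ⟨wz.trans_le (mono z ⟨le_rfl, mz.2⟩ x ⟨hxz, hx.2⟩ hxz),
      (mono x ⟨hxz, hx.2⟩ 1 ⟨mz.2, le_rfl⟩ hx.2).trans_lt w1⟩

/-! ### Regularity -/

/-- Two `BV` functions with the same derivative differ by a constant. -/
theorem HasBVDeriv.exists_ae_eq_const_add {a b : ℝ} (hab : a < b) {u v : ℝ → ℝ}
    {ν : SignedMeasure ℝ} (hu : HasBVDeriv a b u ν) (hv : HasBVDeriv a b v ν) :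
    ∃ C, ∀ᵐ x, x ∈ Ioo a b → u x = C + v x := by
  obtain ⟨C, hC⟩ := exists_ae_eq_const_of_integral_mul_deriv_eq_zero hab
    (hu.integrableOn.sub hv.integrableOn) fun ψ hψ => by
      obtain ⟨K, hK⟩ := hψ.hasCompactSupport.deriv.exists_bound_of_continuous
        (hψ.contDiff.continuous_deriv (by simp))
      have hm := (hψ.contDiff.continuous_deriv (by simp)).aestronglyMeasurable
        (μ := volume.restrict (Ioo a b))
      have e1 := Integrable.mul_bdd hu.integrableOn hm (Eventually.of_forall hK)
      have e2 := Integrable.mul_bdd hv.integrableOn hm (Eventually.of_forall hK)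
      simp_rw [Pi.sub_apply, sub_mul]
      rw [integral_sub e1 e2, hu.integral_eq ψ hψ, hv.integral_eq ψ hψ, sub_self]
  refine ⟨C, ?_⟩
  filter_upwards [hC] with x hx hxm
  have := hx hxm
  simp only [Pi.sub_apply] at this
  linarith

/-- If `Du` is absolutely continuous with a density equal a.e. in `(0, 1)` to a continuous
function, then `u` is a.e. equal to a primitive of that function. -/
theorem HasBVDeriv.exists_ae_eq_integral {u p : ℝ → ℝ} {Du : SignedMeasure ℝ}
    (hu : HasBVDeriv 0 1 u Du) (hs : singPart Du = 0)
    (hp : ∀ᵐ x, x ∈ Ioo (0 : ℝ) 1 → acDensity Du x = p x) :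
    ∃ C, ∀ᵐ x, x ∈ Ioo (0 : ℝ) 1 → u x = C + ∫ t in (0 : ℝ)..x, p t := by
  have hDu : Du = volume.withDensityᵥ (acDensity Du) := by
    conv_lhs => rw [← SignedMeasure.singularPart_add_withDensity_rnDeriv_eq (s := Du) (μ := volume)]
    rw [show Du.singularPart volume = 0 from hs, zero_add]
    rfl
  obtain ⟨C, hC⟩ := hu.exists_ae_eq_const_add zero_lt_one (hasBVDeriv_primitive Du hu.restrict_eq)
  refine ⟨C, ?_⟩
  filter_upwards [hC] with x hx hxm
  rw [hx hxm, primitive]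
  congr 1
  rw [← hu.restrict_eq, VectorMeasure.restrict_apply _ measurableSet_Ioo measurableSet_Iio]
  have : Iio x ∩ Ioo 0 1 = Ioo 0 x := by
    ext y; simp only [mem_inter_iff, mem_Iio, mem_Ioo]
    exact ⟨fun h => ⟨h.2.1, h.1⟩, fun h => ⟨h.2, h.1, h.2.trans hxm.2⟩⟩
  rw [this, hDu, withDensityᵥ_apply (acDensity_integrable Du) measurableSet_Ioo,
    intervalIntegral.integral_of_le hxm.1.le, integral_Ioc_eq_integral_Ioo]
  refine setIntegral_congr_ae measurableSet_Ioo ?_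
  filter_upwards [hp] with y hy hym using hy ⟨hym.1, hym.2.trans hxm.2⟩

/-- `C¹` and `W^{2,1}` regularity from the regularity of the flux `w`. -/
theorem memW21_of_flux {u v w : ℝ → ℝ} {C : ℝ} (hw : Continuous w) (hlt : ∀ x, |w x| < 1)
    (hac : AbsolutelyContinuousOnInterval w 0 1)
    (hv : v = fun x => C + ∫ t in (0 : ℝ)..x, invCurvFlux (w t))
    (huv : ∀ᵐ x, x ∈ Ioo (0 : ℝ) 1 → u x = v x) :
    MemW21 0 1 u ∧ (∀ x, HasDerivAt v (invCurvFlux (w x)) x) ∧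
      Continuous fun x => invCurvFlux (w x) := by
  have hpc : Continuous fun x => invCurvFlux (w x) := continuous_iff_continuousAt.2 fun x =>
    (contDiffAt_invCurvFlux (hlt x)).continuousAt.comp hw.continuousAt
  have hvd : ∀ x, HasDerivAt v (invCurvFlux (w x)) x := fun x => by
    rw [hv]
    exact ((hpc.integral_hasStrictDerivAt 0 x).hasDerivAt).const_add C
  have hderiv : deriv v = fun x => invCurvFlux (w x) := funext fun x => (hvd x).deriv
  have hv1 : ContDiff ℝ 1 v := contDiff_one_iff_deriv.2
    ⟨fun x => (hvd x).differentiableAt, hderiv ▸ hpc⟩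
  obtain ⟨x₀, hx₀, hmax⟩ := isCompact_Icc.exists_isMaxOn (nonempty_Icc.2 zero_le_one)
    hw.abs.continuousOn
  set r := |w x₀| with hr
  -- `invCurvFlux` blows up at `±1`; it is Lipschitz here only because the maximum `r` of `|w|` is
  -- below `1`.
  obtain ⟨K, hK⟩ := ContDiffOn.exists_lipschitzOnWith (n := 1) (f := invCurvFlux) (s := Icc (-r) r)
    (fun t ht => (contDiffAt_invCurvFlux ((abs_le.2 ht).trans_lt (hlt x₀))).contDiffWithinAt)
    one_ne_zero (convex_Icc _ _) isCompact_Icc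
  have hmaps : MapsTo w (uIcc 0 1) (Icc (-r) r) := fun x hx => by
    rw [uIcc_of_le zero_le_one] at hx
    exact abs_le.1 (isMaxOn_iff.1 hmax x hx)
  have hpac : AbsolutelyContinuousOnInterval (invCurvFlux ∘ w) 0 1 :=
    absolutelyContinuousOnInterval_comp_of_lipschitzOnWith hK hac hmaps
  refine ⟨⟨invCurvFlux ∘ w, deriv (invCurvFlux ∘ w), ?_,
    hasWeakDeriv_of_absolutelyContinuous zero_le_one hpac⟩, hvd, hpc⟩
  exact (hasWeakDeriv_of_absolutelyContinuous zero_le_one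
    hv1.contDiffOn.absolutelyContinuousOnInterval).congr huv
    (Eventually.of_forall fun x _ => by rw [hderiv]; rfl)

end PrescribedCurvature

/-! ### Regularity of bounded variation solutions -/

theorem theorem4p4 (f : ℝ → ℝ → ℝ) (lam₀ lam₁ κ₀ κ₁ : ℝ) (hlam₀ : lam₀ ≠ 0) (hlam₁ : lam₁ ≠ 0)
    (u : ℝ → ℝ) (hu : IsBVRobinSolution f lam₀ lam₁ κ₀ κ₁ u)
    (z : ℝ) (hz : z ∈ Set.Ioo (0 : ℝ) 1)
    (hpos : ∀ᵐ x : ℝ, x ∈ Set.Ioo 0 z → 0 ≤ f x (u x))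
    (hneg : ∀ᵐ x : ℝ, x ∈ Set.Ioo z 1 → f x (u x) ≤ 0)
    (h₀ : UpperDecayRight (fun x => f x (u x)) 0)
    (h₁ : LowerDecayLeft (fun x => f x (u x)) 1)
    (h_z : UpperDecayLeft (fun x => f x (u x)) z ∨ LowerDecayRight (fun x => f x (u x)) z) :
    MemW21 0 1 u ∧
    -- `v` is the representative of `u` in `C¹[0,1]` and `p = v'`
    ∃ v p : ℝ → ℝ, (∀ᵐ x : ℝ, x ∈ Set.Ioo 0 1 → u x = v x) ∧
      (∀ x ∈ Set.Icc (0 : ℝ) 1, HasDerivWithinAt v (p x) (Set.Icc 0 1) x) ∧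
      ContinuousOn p (Set.Icc 0 1) ∧
      (∀ᵐ x : ℝ, x ∈ Set.Ioo 0 1 →
        HasDerivAt (fun y => curvFlux (p y)) (-f x (v x)) x) ∧
      curvFlux (p 0) + lam₀ * v 0 = κ₀ ∧
      curvFlux (p 1) + lam₁ * v 1 = κ₁ := by
  obtain ⟨hh, Du, hDu, hweak⟩ := hu
  set h : ℝ → ℝ := fun x => f x (u x) with hdef
  set α := κ₀ - lam₀ * rightTrace u 0 with hα
  set β := lam₁ * leftTrace u 1 - κ₁ with hβ
  have hW : WeakEquation Du h α β := hweak
  -- Nothing is known of `h` outside `(0, 1)`. Extending by zero makes `w` continuous on the line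
  -- and constant on each side of `[0, 1]`, so `|w| < 1` holds everywhere.
  set k := (Ioo (0 : ℝ) 1).indicator h with hk
  have hki : Integrable k := hh.integrable_indicator measurableSet_Ioo
  have hkI : ∀ s t, IntervalIntegrable k volume s t := fun _ _ => hki.intervalIntegrable
  have hkh : ∀ s ∈ Icc (0 : ℝ) 1, ∀ t ∈ Icc (0 : ℝ) 1, ∫ x in s..t, k x = ∫ x in s..t, h x := by
    intro s hs t ht
    wlog hst : s ≤ t generalizing s t
    · rw [intervalIntegral.integral_symm, this t ht s hs (le_of_not_ge hst),
        intervalIntegral.integral_symm, neg_neg]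
    rw [intervalIntegral.integral_of_le hst, intervalIntegral.integral_of_le hst,
      integral_Ioc_eq_integral_Ioo, integral_Ioc_eq_integral_Ioo]
    exact setIntegral_congr_fun measurableSet_Ioo fun x hx =>
      indicator_of_mem (s := Ioo 0 1) ⟨hs.1.trans_lt hx.1, hx.2.trans_le ht.2⟩ _
  set w : ℝ → ℝ := fun x => (∫ t in x..1, k t) - β with hwdef
  have hwsub : ∀ s t, w s - w t = ∫ x in s..t, k x := fun s t => by
    simp only [hwdef]
    rw [← intervalIntegral.integral_add_adjacent_intervals (hkI s t) (hkI t 1)]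
    ring
  have hwh : ∀ x ∈ Icc (0 : ℝ) 1, w x = (∫ t in x..1, h t) - β := fun x hx => by
    rw [hwdef, ← hkh x hx 1 (by simp)]
  have hw0 : w 0 = α := by
    have := hW.boundary_add
    rw [hwh 0 (by simp)]; linarith
  have hw1 : w 1 = -β := by simp [hwdef]
  have hflux : ∀ᵐ x, x ∈ Ioo (0 : ℝ) 1 → curvFlux (acDensity Du x) = w x := by
    filter_upwards [hW.curvFlux_ae_eq hh] with x hx hxm
    rw [hx hxm, hwh x (Ioo_subset_Icc_self hxm)]
  have hlt := abs_flux_lt_one hh (acDensity_integrable Du) hflux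
    (fun s hs t ht => by rw [hwsub, hkh s hs t ht]) hz hpos hneg h₀ h₁ h_z
  have hwform : w = fun x => w 0 - ∫ t in (0 : ℝ)..x, k t := funext fun x => by
    rw [← hwsub]; ring
  have hwc : Continuous w := by
    rw [hwform]
    exact continuous_const.sub (intervalIntegral.continuous_primitive hkI 0)
  have hlt' : ∀ x, |w x| < 1 := by
    have hout : ∀ s t, (∀ x ∈ uIoc s t, k x = 0) → w s = w t := fun s t hst => by
      rw [← sub_eq_zero, hwsub]
      exact intervalIntegral.integral_zero_ae (Eventually.of_forall hst)
    intro x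
    rcases lt_or_ge x 0 with hx | hx
    · rw [hout x 0]
      · exact hlt 0 (by simp)
      · intro y hy
        rw [uIoc_of_le hx.le] at hy
        exact indicator_of_notMem (fun hm => absurd hm.1 (not_lt.2 hy.2)) _
    rcases le_or_gt x 1 with hx1 | hx1
    · exact hlt x ⟨hx, hx1⟩
    · rw [← hout 1 x]
      · exact hlt 1 (by simp)
      · intro y hy
        rw [uIoc_of_le hx1.le] at hy
        exact indicator_of_notMem (fun hm => absurd hm.2 (not_lt.2 hy.1.le)) _
  have hwac : AbsolutelyContinuousOnInterval w 0 1 := by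
    have e1 := (hkI 0 1).absolutelyContinuousOnInterval_intervalIntegral (c := 0) (by simp)
    have e2 : AbsolutelyContinuousOnInterval (fun _ : ℝ => w 0) 0 1 :=
      (contDiff_const (n := 1)).contDiffOn.absolutelyContinuousOnInterval
    rw [hwform]
    exact e2.sub e1
  obtain ⟨x₀, hx₀, hmax⟩ := isCompact_Icc.exists_isMaxOn (nonempty_Icc.2 zero_le_one)
    hwc.abs.continuousOn
  have hs : singPart Du = 0 := hW.singPart_eq_zero hh hDu.restrict_eq (hlt x₀ hx₀) fun x hx => by
    rw [← hwh x (Ioo_subset_Icc_self hx)]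
    exact hmax (Ioo_subset_Icc_self hx)
  obtain ⟨C, hC⟩ := hDu.exists_ae_eq_integral (p := fun x => invCurvFlux (w x)) hs (by
    filter_upwards [hflux] with x hx hxm
    rw [← hx hxm, invCurvFlux_curvFlux])
  set v : ℝ → ℝ := fun x => C + ∫ t in (0 : ℝ)..x, invCurvFlux (w t) with hv
  obtain ⟨hW21, hvd, hpc⟩ := memW21_of_flux hwc hlt' hwac hv hC
  have hvc : Continuous v := continuous_iff_continuousAt.2 fun x => (hvd x).continuousAt
  have hr : rightTrace u 0 = v 0 :=
    (rightTrace_congr zero_lt_one hC).trans (rightTrace_eq hvc.continuousWithinAt)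
  have hl : leftTrace u 1 = v 1 :=
    (leftTrace_congr zero_lt_one hC).trans (leftTrace_eq hvc.continuousWithinAt)
  refine ⟨hW21, v, fun x => invCurvFlux (w x), hC, fun x _ => (hvd x).hasDerivWithinAt,
    hpc.continuousOn, ?_, ?_, ?_⟩
  · simp_rw [curvFlux_invCurvFlux (hlt' _)]
    -- Lebesgue differentiation gives `w' = -k` a.e., and `k x = f x (v x)` wherever `u x = v x`.
    filter_upwards [hC, LocallyIntegrable.ae_hasDerivAt_integral hki.locallyIntegrable] with x hx hd hxm
    have e : k x = f x (v x) := by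
      rw [hk, indicator_of_mem hxm, show v x = u x from (hx hxm).symm]
    rw [← e, hwform]
    exact (hd 0).const_sub (w 0)
  · rw [curvFlux_invCurvFlux (hlt' 0), hw0, hα, hr]; ring
  · rw [curvFlux_invCurvFlux (hlt' 1), hw1, hβ, hl]; ring
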